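/- Let $n\ge 4$. Let $\mathbb R^n$ have its standard inner product and standard basis $e_1,\dots,e_n$, and let $\alpha_i^\vee=\alpha_i=e_i-e_{i+1}$ for $1\le i\le n-1$ and $\alpha_n^\vee=\alpha_n=e_{n-1}+e_n$ be the simple (co)roots of type $D_n$. Let $R^\vee=\bigoplus_{i=1}^n\mathbb Z\alpha_i^\vee$ be the coroot lattice, let $s_i$ be the orthogonal reflection in the hyperplane $\alpha_i^\perp$, and let $W=\langle s_1,\dots,s_n\rangle$ be the finite Weyl group of type $D_n$. For $w\in W$ put $$\operatorname{Mod}(w)=(w-\mathrm{Id})R^\vee,\qquad \operatorname{Mov}(w)=\operatorname{Im}(w-\mathrm{Id})\subseteq\mathbb R^n,$$ and say that $w$ *fills its move-set* if $\operatorname{Mod}(w)=\operatorname{Mov}(w)\cap R^\vee$. The conjugacy classes of $W$ are indexed by the pairs $(\beta,\delta)$ of partitions (with positive parts, either partition possibly empty) such that $\beta=(\beta_1\ge\dots\ge\beta_p)$, $\delta=(\delta_1\le\dots\le\delta_{2r})$ has an even number of parts, and $|\beta|+|\delta|=n$; the class indexed by $(\beta,\delta)$ is that of $w_{\beta,\delta}=w_\beta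 w_\delta$, except that if $|\delta|=0$ and all parts of $\beta$ are even, there are two classes indexed by $(\beta,\delta)$, those of $w_{\beta^+}=w_\beta$ and $w_{\beta^-}$. Here: * $w_\beta=\prod_{k=1}^p s_{j_k+1}s_{j_k+2}\cdots s_{j_k+\beta_k-1}$ (factors in order of increasing $k$), where $j_k=\beta_1+\dots+\beta_{k-1}$; and $w_{\beta^-}$ is obtained from this word by replacing $s_{n-1}$ by $s_n$. * Let $u_0=s_n$, $u_1=s_ns_{n-1}$ and $u_j=s_{n-j}u_{j-1}s_{n-j}$ for $2\le j\le n-1$. For $2\le k\le 2r$ let $i_k=\delta_1+\dots+\delta_{k-1}$ and $v_k=u_{i_k}s_{n-(i_k+1)}s_{n-(i_k+2)}\cdots s_{n-(i_k+\delta_k-1)}$ (so $v_k=u_{i_k}$ if $\delta_k=1$). Then $w_\delta=1$ if $|\delta|=0$, $w_\delta=v_2v_3\cdots v_{2r}$ if $\delta_1=1$, and $w_\delta=(u_0s_{n-2}s_{n-3}\cdots s_{n-(\delta_1-1)})\,v_2v_3\cdots v_{2r}$ if $\delta_1\ge2$. **Corollary.** Let $w\in W$, and let the conjugacy class of $w$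 in $W$ be indexed by $(\beta,\delta)$. Then $w$ fills its move-set if and only if $\beta$ has at least one odd part and $|\delta|=0$. In particular, if the conjugacy class of $w\in W$ is not represented by an element $w_{\beta}$, with $\beta$ a partition of $n$, of the type $A_{n-1}$ subsystem $\langle s_1,\dots,s_{n-1}\rangle$, then $w$ does not fill its move-set. -/

import Mathlib

noncomputable section

namespace TypeD

/-- Euclidean space of dimension `n`; `V` and its dual are identified by the inner product. -/
abbrev V (n : ℕ) : Type := EuclideanSpace ℝ (Fin n)

/-- The standard basis vector `e_k`, for `1 ≤ k ≤ n` (and `0` for other `k`). -/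
def e (n k : ℕ) : V n := WithLp.toLp 2 fun j : Fin n => if (j : ℕ) + 1 = k then 1 else 0

/-- The simple roots of type `D_n` in the labeling of Bourbaki:
`α_i = e_i - e_{i+1}` for `1 ≤ i ≤ n - 1`, and `α_n = e_{n-1} + e_n`.
Only the indices `1 ≤ i ≤ n` are used. -/
def simpleRoot (n i : ℕ) : V n :=
  if i = n then e n (n - 1) + e n n else e n i - e n (i + 1)

/-- The simple coroots `α_i^∨ = 2 α_i / (α_i, α_i)`. -/
def simpleCoroot (n i : ℕ) : V n :=
  (2 / inner ℝ (simpleRoot n i) (simpleRoot n i)) • simpleRoot n i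

/-- The coroot lattice `R^∨`, the `ℤ`-span of the simple coroots. -/
def corootLattice (n : ℕ) : Submodule ℤ (V n) :=
  Submodule.span ℤ {v | ∃ i, 1 ≤ i ∧ i ≤ n ∧ v = simpleCoroot n i}

/-- The orthogonal reflection in the hyperplane perpendicular to `α_i`. -/
def rootReflection (n i : ℕ) : V n ≃ₗᵢ[ℝ] V n :=
  (Submodule.span ℝ {simpleRoot n i})ᗮ.reflection

/-- The finite Weyl group of type `D_n`, generated by the simple reflections `s_1, …, s_n`.
The product of the group is the composition of maps. -/
def weylGroup (n : ℕ) : Subgroup (V n ≃ₗᵢ[ℝ] V n) :=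
  Subgroup.closure {g | ∃ i, 1 ≤ i ∧ i ≤ n ∧ g = rootReflection n i}

/-- The simple reflection `s_i`, as an element of the Weyl group, for `1 ≤ i ≤ n`
(and `1` for other `i`, which are never used). -/
def s (n i : ℕ) : weylGroup n :=
  if h : 1 ≤ i ∧ i ≤ n then
    ⟨rootReflection n i, Subgroup.subset_closure ⟨i, h.1, h.2, rfl⟩⟩
  else 1

/-- The subgroup generated by `s_1, …, s_{n-1}`: the subsystem of type `A_{n-1}`. -/
def typeASubgroup (n : ℕ) : Subgroup (weylGroup n) :=
  Subgroup.closure {g | ∃ i, 1 ≤ i ∧ i < n ∧ g = s n i}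

/-- The move-set `Mov(w) = Im(w - Id)`. -/
def moveSet {n : ℕ} (w : weylGroup n) : Set (V n) :=
  {p | ∃ q : V n, q + p = w.1 q}

/-- The mod-set `Mod(w) = (w - Id) R^∨`. -/
def modSet {n : ℕ} (w : weylGroup n) : Set (V n) :=
  (fun v => w.1 v - v) '' (corootLattice n : Set (V n))

/-- `w` fills its move-set: `Mod(w) = Mov(w) ∩ R^∨`. -/
def FillsMoveSet {n : ℕ} (w : weylGroup n) : Prop :=
  modSet w = moveSet w ∩ (corootLattice n : Set (V n))

/-- The product of simple reflections along a list of indices. -/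
def wordProd (n : ℕ) (l : List ℕ) : weylGroup n := (l.map (s n)).prod

/-- The indices, in increasing order, of the simple reflections in the blocks of `β`; the block of
a part `b` that starts at `j` is `j + 1, …, j + (b - 1)`, and the next block starts at `j + b`. -/
def betaWord : ℕ → List ℕ → List ℕ
  | _, [] => []
  | j, b :: bs => List.range' (j + 1) (b - 1) ++ betaWord (j + b) bs

/-- The element `w_β`. For a partition of `n` with all parts even it is also called `w_{β⁺}`. -/
def wBeta (n : ℕ) (β : List ℕ) : weylGroup n := wordProd n (betaWord 0 β)

/-- The element `w_{β⁻}`: replace `s_{n-1}` by `s_n` in `w_β`. -/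
def wBetaMinus (n : ℕ) (β : List ℕ) : weylGroup n :=
  wordProd n ((betaWord 0 β).map fun i => if i = n - 1 then n else i)

/-- `u_0 = s_n`, `u_1 = s_n s_{n-1}`, and `u_j = s_{n-j} u_{j-1} s_{n-j}` for `j ≥ 2`. -/
def u (n : ℕ) : ℕ → weylGroup n
  | 0 => s n n
  | 1 => s n n * s n (n - 1)
  | j + 2 => s n (n - (j + 2)) * u n (j + 1) * s n (n - (j + 2))

/-- For a part `d` that starts at `j`, the element `u_j s_{n-(j+1)} ⋯ s_{n-(j+d-1)}`. -/
def v (n j d : ℕ) : weylGroup n :=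
  u n j * wordProd n ((List.range' (j + 1) (d - 1)).map fun i => n - i)

/-- The product of the elements `v` over consecutive parts, the first of which starts at `j`. -/
def vProd (n : ℕ) : ℕ → List ℕ → weylGroup n
  | _, [] => 1
  | j, d :: ds => v n j d * vProd n (j + d) ds

/-- The element `w_δ`. If `δ_1 ≥ 2`, it is `(u_0 s_{n-2} s_{n-3} ⋯ s_{n-(δ_1-1)}) v_2 ⋯ v_{2r}`.
If `δ_1 = ⋯ = δ_ℓ = 1` and `δ_{ℓ+1} ≥ 2`, it is `(u_1 ⋯ u_{ℓ-1}) v_{ℓ+1} ⋯ v_{2r}`, and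
if all the parts are `1`, it is `u_1 u_2 ⋯ u_{2r-1}`. In the last two cases this is
`v_2 ⋯ v_{2r}`, because `v` of a part `1` that starts at `j` is `u_j`. -/
def wDelta (n : ℕ) : List ℕ → weylGroup n
  | [] => 1
  | d :: ds =>
    (if 2 ≤ d then u n 0 * wordProd n ((List.range' 2 (d - 2)).map fun i => n - i) else 1) *
      vProd n d ds

/-- `β` is a partition of `m`, written as a weakly decreasing list of positive parts. -/
structure IsDecreasingPartition (β : List ℕ) (m : ℕ) : Prop where
  pos : ∀ b ∈ β, 0 < b
  decreasing : β.Pairwise (· ≥ ·)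
  sum_eq : β.sum = m

/-- The pairs of partitions `(β, δ)` with `|β| + |δ| = n`, `β` weakly decreasing, and `δ` weakly
increasing with an even number of parts. -/
structure IsIndexPair (n : ℕ) (β δ : List ℕ) : Prop where
  beta_pos : ∀ b ∈ β, 0 < b
  beta_decreasing : β.Pairwise (· ≥ ·)
  delta_pos : ∀ d ∈ δ, 0 < d
  delta_increasing : δ.Pairwise (· ≤ ·)
  delta_even : Even δ.length
  sum_eq : β.sum + δ.sum = n

/-- The conjugacy class of `w` in the Weyl group is indexed by `(β, δ)`: it contains the
representative `w_{β,δ} = w_β w_δ`, or, if `|δ| = 0` and all parts of `β` are even, one of the two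
representatives `w_{β⁺}`, `w_{β⁻}`. -/
def ClassIndexedBy {n : ℕ} (w : weylGroup n) (β δ : List ℕ) : Prop :=
  IsIndexPair n β δ ∧
    (IsConj w (wBeta n β * wDelta n δ) ∨
      ((δ.sum = 0 ∧ ∀ b ∈ β, Even b) ∧ IsConj w (wBetaMinus n β)))

end TypeD

end

/-!
The Weyl group of type `D_n` consists of the signed permutation matrices with an even number of
signs, and the coroot lattice consists of the integral vectors with even coordinate sum. The proof
rests on a criterion that involves only fixed vectors (`fillsMoveSet_iff`): `w` fills its move-set
if and only if

* `w` fixes a vector without zero coordinates (no cycle of the signed permutation is negative), and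
* `w` fixes an integral vector with odd coordinate sum (given the first condition: some cycle has
  odd length).

For the necessity of the first condition, take `h = (1/2, …, 1/2)`. As the number of signs of `w`
is even, `(w - 1)h` is a coroot lattice vector in the move-set. If it equals `(w - 1)z` with `z` in
the lattice, then `h - z` is fixed and has no zero coordinate. For the second one, the same argument
with `h = e_1` produces a fixed integral vector `z - e_1` with odd sum. Conversely, let `t` be the
sign vector of a fixed vector without zero coordinates, and let `(w - 1)q` be integral. Then the
vector of the numbers `t_i * fract (t_i * q_i)` is fixed, so that subtracting it from `q` makes `q`
integral, and the second condition serves to correct the parity of the coordinate sum.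

The criterion is invariant under conjugation and is checked on the representatives. An element
`w_β` fixes `(1, …, 1)` and the indicator vectors of its blocks. If all parts of `β` are even, then
a vector fixed by `w_β` or `w_{β⁻}` is fixed by each simple reflection in the word
(`s_apply_eq_self_of_wordProd`), so that its coordinates agree in pairs up to sign. If `δ` is not
empty, then a fixed vector of `w_β w_δ` has a zero coordinate (`not_fillsMoveSet_of_delta`), as one
sees from the sum of the first `n - j` coordinates, where `j` is the start of the last part of `δ`.

Finally, if `w` fills its move-set, then the two fixed vectors of the criterion combine to a fixed
sign vector with an even number of signs. Conjugation by the corresponding diagonal matrix, which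
lies in the Weyl group, turns `w` into a permutation matrix, and this is conjugate to `w_β`, with
`β` its cycle type (`exists_isConj_wBeta`).
-/

noncomputable section

namespace TypeD

/-! ### Roots and reflections in coordinates -/

theorem rootReflection_apply {n i : ℕ} (h : inner ℝ (simpleRoot n i) (simpleRoot n i) = (2 : ℝ))
    (x : V n) :
    rootReflection n i x = x - (inner ℝ (simpleRoot n i) x : ℝ) • simpleRoot n i := by
  unfold rootReflection
  rw [Submodule.reflection_orthogonal_apply, Submodule.reflection_singleton_apply]
  rw [real_inner_self_eq_norm_sq] at h
  simp only [RCLike.ofReal_real_eq_id, id_eq, h]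
  module

theorem e_apply_fin {n : ℕ} (j : Fin n) : e n ((j : ℕ) + 1) = EuclideanSpace.single j (1 : ℝ) := by
  ext k
  simp [e, Fin.ext_iff]

theorem simpleRoot_of_lt {n i : ℕ} (h1 : 1 ≤ i) (h2 : i < n) :
    simpleRoot n i = EuclideanSpace.single ⟨i - 1, by omega⟩ (1 : ℝ) -
      EuclideanSpace.single ⟨i, h2⟩ (1 : ℝ) := by
  rw [simpleRoot, if_neg h2.ne, ← e_apply_fin, ← e_apply_fin]
  simp only [Nat.sub_add_cancel h1]

theorem simpleRoot_last {n : ℕ} (hn : 2 ≤ n) :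
    simpleRoot n n = EuclideanSpace.single ⟨n - 2, by omega⟩ (1 : ℝ) +
      EuclideanSpace.single ⟨n - 1, by omega⟩ (1 : ℝ) := by
  rw [simpleRoot, if_pos rfl, ← e_apply_fin, ← e_apply_fin]
  simp only [show n - 2 + 1 = n - 1 by omega, show n - 1 + 1 = n by omega]

theorem inner_simpleRoot_self {n i : ℕ} (hn : 2 ≤ n) (h1 : 1 ≤ i) (h2 : i ≤ n) :
    inner ℝ (simpleRoot n i) (simpleRoot n i) = (2 : ℝ) := by
  rcases h2.lt_or_eq with h | rfl
  · rw [simpleRoot_of_lt h1 h]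
    have : i - 1 ≠ i := by omega
    simp only [inner_sub_left, EuclideanSpace.inner_single_left]
    simp [this, this.symm]
    norm_num
  · rw [simpleRoot_last hn]
    have : i - 2 ≠ i - 1 := by omega
    simp only [inner_add_left, EuclideanSpace.inner_single_left]
    simp [this, this.symm]
    norm_num

theorem simpleCoroot_eq {n i : ℕ} (hn : 2 ≤ n) (h1 : 1 ≤ i) (h2 : i ≤ n) :
    simpleCoroot n i = simpleRoot n i := by
  rw [simpleCoroot, inner_simpleRoot_self hn h1 h2]; simp

theorem s_apply_of_lt {n i : ℕ} (h1 : 1 ≤ i) (h2 : i < n) (x : V n) (k : Fin n) :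
    (s n i).1 x k = x (Equiv.swap ⟨i - 1, by omega⟩ ⟨i, h2⟩ k) := by
  rw [s, dif_pos ⟨h1, h2.le⟩]
  dsimp only
  rw [rootReflection_apply (inner_simpleRoot_self (by omega) h1 h2.le), simpleRoot_of_lt h1 h2]
  have : i - 1 ≠ i := by omega
  simp only [inner_sub_left, EuclideanSpace.inner_single_left, Equiv.swap_apply_def]
  split_ifs with ha hb
  · subst ha; simp [this]
  · subst hb; simp [this.symm]
  · simp [ha, hb]

theorem s_last_apply {n : ℕ} (hn : 2 ≤ n) (x : V n) (k : Fin n) :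
    (s n n).1 x k = if (k : ℕ) = n - 2 then - x ⟨n - 1, by omega⟩ else
      if (k : ℕ) = n - 1 then - x ⟨n - 2, by omega⟩ else x k := by
  rw [s, dif_pos ⟨by omega, le_rfl⟩]
  dsimp only
  rw [rootReflection_apply (inner_simpleRoot_self (by omega) (by omega) le_rfl),
    simpleRoot_last hn]
  have : n - 2 ≠ n - 1 := by omega
  obtain ⟨k, hk⟩ := k
  simp only [inner_add_left, EuclideanSpace.inner_single_left]
  split_ifs with ha hb
  · subst ha; simp [this]
  · subst hb; simp [this.symm]
  · simp [ha, hb]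

/-! ### Signed permutations and the coroot lattice -/

/-- The isometry `g` is the signed permutation `e_i ↦ ε_i e_{σ i}`, expressed in coordinates. -/
def IsSignedPerm {n : ℕ} (g : V n ≃ₗᵢ[ℝ] V n) (σ : Equiv.Perm (Fin n)) (ε : Fin n → ℤˣ) : Prop :=
  ∀ x i, g x (σ i) = ((ε i : ℤ) : ℝ) * x i

theorem isSignedPerm_s_of_lt {n i : ℕ} (h1 : 1 ≤ i) (h2 : i < n) :
    IsSignedPerm (s n i).1 (Equiv.swap ⟨i - 1, by omega⟩ ⟨i, h2⟩) 1 := by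
  intro x k
  rw [s_apply_of_lt h1 h2]; simp

theorem IsSignedPerm.mul {n : ℕ} {g h : V n ≃ₗᵢ[ℝ] V n} {σ τ : Equiv.Perm (Fin n)}
    {ε η : Fin n → ℤˣ} (hg : IsSignedPerm g σ ε) (hh : IsSignedPerm h τ η) :
    IsSignedPerm (g * h) (σ * τ) (fun i => ε (τ i) * η i) := by
  intro x i
  rw [LinearIsometryEquiv.coe_mul, Function.comp_apply, Equiv.Perm.mul_apply, hg, hh]
  push_cast; ring

theorem IsSignedPerm.inv {n : ℕ} {g : V n ≃ₗᵢ[ℝ] V n} {σ : Equiv.Perm (Fin n)}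
    {ε : Fin n → ℤˣ} (hg : IsSignedPerm g σ ε) :
    IsSignedPerm g⁻¹ σ⁻¹ (fun i => ε (σ⁻¹ i)) := by
  intro x i
  have h := hg (g⁻¹ x) (σ⁻¹ i)
  rw [← Function.comp_apply (f := g), ← LinearIsometryEquiv.coe_mul, mul_inv_cancel] at h
  simp only [← Equiv.Perm.mul_apply, mul_inv_cancel, Equiv.Perm.one_apply,
    LinearIsometryEquiv.coe_one, id_eq] at h
  dsimp only
  rw [h, ← mul_assoc]
  rcases Int.units_eq_one_or (ε (σ⁻¹ i)) with h | h <;> rw [h] <;> norm_num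

/-- Every element of the Weyl group is a signed permutation with an even number of signs. -/
theorem exists_isSignedPerm {n : ℕ} (hn : 2 ≤ n) (w : weylGroup n) :
    ∃ σ ε, IsSignedPerm w.1 σ ε ∧ ∏ i, ε i = 1 := by
  obtain ⟨w, hw⟩ := w
  dsimp only
  induction hw using Subgroup.closure_induction with
  | mem g hg =>
    obtain ⟨i, h1, h2, rfl⟩ := hg
    have hs : rootReflection n i = (s n i).1 := by rw [s, dif_pos ⟨h1, h2⟩]
    rw [hs]
    rcases h2.lt_or_eq with h | rfl
    · exact ⟨_, _, isSignedPerm_s_of_lt h1 h, by simp⟩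
    · have hne : (⟨i - 2, by omega⟩ : Fin i) ≠ ⟨i - 1, by omega⟩ := by
        simp only [ne_eq, Fin.mk.injEq]; omega
      refine ⟨Equiv.swap ⟨i - 2, by omega⟩ ⟨i - 1, by omega⟩,
        fun k => (if k = ⟨i - 2, by omega⟩ then -1 else 1) *
          (if k = ⟨i - 1, by omega⟩ then -1 else 1), ?_, ?_⟩
      · intro x k
        rw [s_last_apply hn, Equiv.swap_apply_def]
        have : i - 1 ≠ i - 2 := by omega
        by_cases ha : k = ⟨i - 2, by omega⟩
        · subst ha; simp [this, hne]
        by_cases hb : k = ⟨i - 1, by omega⟩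
        · subst hb; simp [this]
        · simp only [if_neg ha, if_neg hb, mul_one, Units.val_one, Int.cast_one, one_mul]
          simp only [Fin.ext_iff] at ha hb
          rw [if_neg ha, if_neg hb]
      · rw [Finset.prod_mul_distrib, Finset.prod_ite_eq' , Finset.prod_ite_eq']
        simp
  | one => exact ⟨1, 1, fun x i => by simp, by simp⟩
  | mul g h _ _ hg hh =>
    obtain ⟨σ, ε, hg, hε⟩ := hg
    obtain ⟨τ, η, hh, hη⟩ := hh
    refine ⟨_, _, hg.mul hh, ?_⟩
    rw [Finset.prod_mul_distrib, Equiv.prod_comp τ ε, hε, hη, one_mul]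
  | inv g _ hg =>
    obtain ⟨σ, ε, hg, hε⟩ := hg
    exact ⟨_, _, hg.inv, by rw [Equiv.prod_comp σ⁻¹ ε, hε]⟩

/-- The coroot lattice of type `D_n`: the integral vectors with even coordinate sum. -/
theorem mem_corootLattice_iff {n : ℕ} (hn : 2 ≤ n) (x : V n) :
    x ∈ corootLattice n ↔ ∃ a : Fin n → ℤ, (∀ i, x i = a i) ∧ Even (∑ i, a i) := by
  constructor
  · intro hx
    induction hx using Submodule.span_induction with
    | mem x hx =>
      obtain ⟨i, h1, h2, rfl⟩ := hx
      rw [simpleCoroot_eq hn h1 h2]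
      rcases h2.lt_or_eq with h | rfl
      · rw [simpleRoot_of_lt h1 h]
        refine ⟨Pi.single ⟨i - 1, by omega⟩ 1 - Pi.single ⟨i, h⟩ 1, fun k => ?_, ?_⟩
        · simp [Pi.single_apply]
        · simp
      · rw [simpleRoot_last hn]
        refine ⟨Pi.single ⟨i - 2, by omega⟩ 1 + Pi.single ⟨i - 1, by omega⟩ 1, fun k => ?_, ?_⟩
        · simp [Pi.single_apply]
        · simp [Finset.sum_add_distrib]
    | zero => exact ⟨0, by simp, by simp⟩
    | add x y _ _ hx hy =>
      obtain ⟨a, ha, ha'⟩ := hx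
      obtain ⟨b, hb, hb'⟩ := hy
      refine ⟨a + b, fun i => by simp [ha, hb], ?_⟩
      simpa [Finset.sum_add_distrib] using ha'.add hb'
    | smul c x _ hx =>
      obtain ⟨a, ha, ha'⟩ := hx
      refine ⟨c • a, fun i => by simp [ha], ?_⟩
      simpa [← Finset.mul_sum] using ha'.mul_left c
  · rintro ⟨a, ha, r, hr⟩
    let l : Fin n := ⟨n - 1, by omega⟩
    have hroot : ∀ i, 1 ≤ i → i ≤ n → simpleRoot n i ∈ corootLattice n := fun i h1 h2 =>
      Submodule.subset_span ⟨i, h1, h2, (simpleCoroot_eq hn h1 h2).symm⟩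
    have hdiff : ∀ d (k : Fin n), (k : ℕ) + d = n - 1 →
        EuclideanSpace.single k (1 : ℝ) - EuclideanSpace.single l (1 : ℝ) ∈ corootLattice n := by
      intro d
      induction d with
      | zero =>
        intro k hk
        rw [show k = l from Fin.ext hk, sub_self]
        exact zero_mem _
      | succ d ih =>
        intro k hk
        have h := hroot (k + 1) (by omega) (by omega)
        rw [simpleRoot_of_lt (by omega) (by omega)] at h
        have h' := ih ⟨k + 1, by omega⟩ (by dsimp only; omega)
        simpa using add_mem h h'
    have htwo : (2 : ℤ) • EuclideanSpace.single l (1 : ℝ) ∈ corootLattice n := by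
      have h := hroot n (by omega) le_rfl
      rw [simpleRoot_last hn] at h
      have h' := sub_mem h (hdiff 1 ⟨n - 2, by omega⟩ (by dsimp only; omega))
      convert h' using 1
      rw [two_smul]; abel
    have hx : x = ∑ i, a i • (EuclideanSpace.single i (1 : ℝ) - EuclideanSpace.single l (1 : ℝ)) +
        r • ((2 : ℤ) • EuclideanSpace.single l (1 : ℝ)) := by
      simp only [smul_sub, Finset.sum_sub_distrib, ← Finset.sum_smul, hr]
      rw [smul_smul, mul_two, sub_add_cancel]
      ext k
      simp [ha, Pi.single_apply]
    rw [hx]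
    refine add_mem (sum_mem fun i _ => Submodule.smul_mem _ _ (hdiff (n - 1 - i) i (by omega)))
      (Submodule.smul_mem _ _ htwo)

/-- The sum of `ε_i - 1` and `∏ ε_i - 1` agree modulo `4`. -/
theorem sum_units_sub_one {ι : Type*} (t : Finset ι) (ε : ι → ℤˣ) :
    (4 : ℤ) ∣ ∑ i ∈ t, ((ε i : ℤ) - 1) - (((∏ i ∈ t, ε i : ℤˣ) : ℤ) - 1) := by
  classical
  induction t using Finset.induction_on with
  | empty => simp
  | insert a t ha ih =>
    rw [Finset.sum_insert ha, Finset.prod_insert ha]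
    rcases Int.units_eq_one_or (ε a) with h | h <;>
      rcases Int.units_eq_one_or (∏ i ∈ t, ε i) with h' | h' <;>
      rw [h'] at ih ⊢ <;> rw [h] <;> push_cast at ih ⊢ <;> omega

theorem even_sum_units_mul_sub_sum {ι : Type*} [Fintype ι] (ε : ι → ℤˣ) (a : ι → ℤ) :
    Even (∑ i, (ε i : ℤ) * a i - ∑ i, a i) := by
  rw [← Finset.sum_sub_distrib]
  refine Finset.even_sum _ fun i _ => ?_
  rcases Int.units_eq_one_or (ε i) with h | h
  · simp [h]
  · exact ⟨-a i, by simp [h]; ring⟩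

/-! ### The criterion for filling the move-set -/

theorem mem_moveSet_of_apply_sub {n : ℕ} (w : weylGroup n) (q : V n) : w.1 q - q ∈ moveSet w :=
  ⟨q, by abel⟩

/-- A Weyl group element fills its move-set if and only if it fixes a vector without zero
coordinates and an integral vector with odd coordinate sum. -/
theorem fillsMoveSet_iff {n : ℕ} (hn : 2 ≤ n) (w : weylGroup n) :
    FillsMoveSet w ↔ (∃ x : V n, w.1 x = x ∧ ∀ i, x i ≠ 0) ∧
      ∃ (z : V n) (a : Fin n → ℤ), w.1 z = z ∧ (∀ i, z i = a i) ∧ Odd (∑ i, a i) := by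
  obtain ⟨σ, ε, hw, hε⟩ := exists_isSignedPerm hn w
  have hsub : ∀ p ∈ moveSet w, p ∈ corootLattice n → FillsMoveSet w →
      ∃ x ∈ corootLattice n, w.1 x - x = p := fun p hp hp' hf => by
    have : p ∈ modSet w := by rw [hf]; exact ⟨hp, hp'⟩
    obtain ⟨x, hx, h⟩ := this
    exact ⟨x, hx, h⟩
  constructor
  · refine fun hf => ⟨?_, ?_⟩
    · -- `(w - 1)(1/2, …, 1/2)` lies in the coroot lattice, as the number of signs of `w` is even.
      let h : V n := WithLp.toLp 2 fun _ => 1 / 2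
      have hmem : w.1 h - h ∈ corootLattice n := by
        rw [mem_corootLattice_iff hn]
        refine ⟨fun k => ((ε (σ.symm k) : ℤ) - 1) / 2, fun k => ?_, ?_⟩
        · obtain ⟨i, rfl⟩ := σ.surjective k
          have hh : ∀ j, h j = 1 / 2 := fun _ => rfl
          rw [PiLp.sub_apply, hw, hh]
          simp only [Equiv.symm_apply_apply]
          rcases Int.units_eq_one_or (ε i) with h' | h' <;> rw [h'] <;> norm_num
        · rw [Equiv.sum_comp σ.symm fun i => ((ε i : ℤ) - 1) / 2]
          have h4 := sum_units_sub_one Finset.univ ε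
          rw [hε] at h4
          have : ∑ i, ((ε i : ℤ) - 1) = 2 * ∑ i, ((ε i : ℤ) - 1) / 2 := by
            rw [Finset.mul_sum]
            refine Finset.sum_congr rfl fun i _ => ?_
            rcases Int.units_eq_one_or (ε i) with h | h <;> simp [h]
          rw [this] at h4
          rw [Int.even_iff]
          push_cast at h4; omega
      obtain ⟨z, hz, hzw⟩ := hsub _ (mem_moveSet_of_apply_sub w h) hmem hf
      obtain ⟨a, ha, -⟩ := (mem_corootLattice_iff hn z).1 hz
      refine ⟨h - z, ?_, fun i => ?_⟩
      · rw [map_sub, sub_eq_sub_iff_sub_eq_sub, hzw]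
      · rw [PiLp.sub_apply, ha]
        intro h0
        have h1 : (1 : ℝ) = ((2 * a i : ℤ) : ℝ) := by
          have hh : h i = 1 / 2 := rfl
          rw [hh] at h0
          push_cast; linarith
        have h2 : (1 : ℤ) = 2 * a i := by exact_mod_cast h1
        omega
    · let i₀ : Fin n := ⟨0, by omega⟩
      have hmem : w.1 (EuclideanSpace.single i₀ 1) - EuclideanSpace.single i₀ 1 ∈
          corootLattice n := by
        rw [mem_corootLattice_iff hn]
        refine ⟨Pi.single (σ i₀) (ε i₀ : ℤ) - Pi.single i₀ 1, fun k => ?_, ?_⟩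
        · obtain ⟨i, rfl⟩ := σ.surjective k
          rw [PiLp.sub_apply, hw]
          by_cases hi : i = i₀
          · subst hi; simp [Pi.single_apply]
          · simp [Pi.single_apply, hi]
        · rcases Int.units_eq_one_or (ε i₀) with h | h <;> simp [h]
      obtain ⟨z, hz, hzw⟩ := hsub _ (mem_moveSet_of_apply_sub w _) hmem hf
      obtain ⟨a, ha, hodd⟩ := (mem_corootLattice_iff hn z).1 hz
      refine ⟨z - EuclideanSpace.single i₀ 1, a - Pi.single i₀ 1, ?_, fun i => ?_, ?_⟩
      · rw [map_sub, sub_eq_sub_iff_sub_eq_sub, hzw]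
      · simp [ha, Pi.single_apply]
      · simpa [Finset.sum_sub_distrib] using hodd.sub_odd odd_one
  · rintro ⟨⟨x, hxw, hx⟩, z, c, hzw, hz, hodd⟩
    apply Set.Subset.antisymm
    · rintro _ ⟨y, hy, rfl⟩
      refine ⟨mem_moveSet_of_apply_sub w y, ?_⟩
      obtain ⟨a, ha, heven⟩ := (mem_corootLattice_iff hn y).1 hy
      refine (mem_corootLattice_iff hn _).2 ⟨fun k => ε (σ.symm k) * a (σ.symm k) - a k,
        fun k => ?_, ?_⟩
      · obtain ⟨i, rfl⟩ := σ.surjective k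
        simp only [PiLp.sub_apply, hw y, ha, Equiv.symm_apply_apply]
        push_cast; rfl
      · rw [Finset.sum_sub_distrib, Equiv.sum_comp σ.symm fun i => (ε i : ℤ) * a i]
        exact even_sum_units_mul_sub_sum ε a
    · rintro p ⟨⟨q, hq⟩, hp⟩
      obtain ⟨b, hb, -⟩ := (mem_corootLattice_iff hn p).1 hp
      -- The sign vector of `x` is fixed by `w`.
      let t : Fin n → ℤ := fun i => if 0 < x i then 1 else -1
      have ht : ∀ i, t (σ i) = ε i * t i := fun i => by
        have h1 := hw x i
        rw [hxw] at h1
        have h2 := hx i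
        simp only [t, h1]
        rcases Int.units_eq_one_or (ε i) with h | h
        · simp [h]
        · rcases h2.lt_or_gt with h2 | h2 <;> simp [h, h2, h2.not_gt]
      have htt : ∀ i, t i * t i = 1 := fun i => by
        simp only [t]; split_ifs <;> norm_num
      have htt' : ∀ i, (t i : ℝ) * t i = 1 := fun i => by exact_mod_cast htt i
      have hεε : ∀ i, ((ε i : ℤ) : ℝ) * (ε i : ℤ) = 1 := fun i => by
        rcases Int.units_eq_one_or (ε i) with h | h <;> simp [h]
      -- Up to the signs, `w` permutes the classes of the coordinates of `q` modulo integers,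
      -- so the vector of fractional parts is fixed and `q` can be made integral.
      have hfr : ∀ i, Int.fract (t (σ i) * q (σ i)) = Int.fract (t i * q i) := fun i => by
        have h1 := hw q i
        rw [← hq, PiLp.add_apply, hb] at h1
        rw [Int.fract_eq_fract]
        refine ⟨- (t (σ i) * b (σ i)), ?_⟩
        have h2 : q (σ i) = ((ε i : ℤ) : ℝ) * q i - b (σ i) := by linarith
        rw [h2, ht]
        push_cast
        linear_combination (t i * q i) * hεε i
      let f : V n := WithLp.toLp 2 fun i => t i * Int.fract (t i * q i)
      have hf : w.1 f = f := by
        ext k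
        obtain ⟨i, rfl⟩ := σ.surjective k
        rw [hw]
        simp only [f]
        rw [hfr, ht]
        push_cast; ring
      have hint : ∀ i, (q - f) i = ((t i * ⌊t i * q i⌋ : ℤ) : ℝ) := fun i => by
        simp only [PiLp.sub_apply, f, Int.fract]
        push_cast
        linear_combination -(q i) * htt' i
      have hqf : w.1 (q - f) - (q - f) = p := by
        rw [map_sub, hf, ← hq]; abel
      rcases Int.even_or_odd (∑ i, t i * ⌊t i * q i⌋) with he | ho
      · exact ⟨q - f, (mem_corootLattice_iff hn _).2 ⟨_, hint, he⟩, hqf⟩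
      · refine ⟨q - f + z, (mem_corootLattice_iff hn _).2
          ⟨fun i => t i * ⌊t i * q i⌋ + c i, fun i => ?_, ?_⟩, ?_⟩
        · rw [PiLp.add_apply, hint, hz]; push_cast; rfl
        · rw [Finset.sum_add_distrib]; exact ho.add_odd hodd
        · dsimp only
          rw [map_add, hzw, ← hqf]; abel

/-! ### Words -/

theorem coe_mul_apply {n : ℕ} (g h : weylGroup n) (x : V n) : (g * h).1 x = g.1 (h.1 x) := rfl

theorem wordProd_cons (n i : ℕ) (l : List ℕ) : wordProd n (i :: l) = s n i * wordProd n l := by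
  simp [wordProd]

theorem wordProd_append (n : ℕ) (l l' : List ℕ) :
    wordProd n (l ++ l') = wordProd n l * wordProd n l' := by
  simp [wordProd]

theorem vProd_append (n : ℕ) (ds : List ℕ) (d j : ℕ) :
    vProd n j (ds ++ [d]) = vProd n j ds * v n (j + ds.sum) d := by
  induction ds generalizing j with
  | nil => simp [vProd]
  | cons a ds ih => simp [vProd, ih, mul_assoc, add_assoc]

/-! ### Fixed vectors of ordered words -/

/-- The smallest index of a nonzero coordinate of `α_i`, counted from `1`. -/
def leadIndex (n i : ℕ) : ℕ := if i = n then n - 1 else i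

theorem s_apply_of_lt_leadIndex {n i : ℕ} (hn : 2 ≤ n) (h1 : 1 ≤ i) (h2 : i ≤ n) (x : V n)
    (k : Fin n) (hk : (k : ℕ) + 1 < leadIndex n i) : (s n i).1 x k = x k := by
  rw [leadIndex] at hk
  split_ifs at hk with h
  · subst h
    rw [s_last_apply hn, if_neg (by omega), if_neg (by omega)]
  · rw [s_apply_of_lt h1 (by omega), Equiv.swap_apply_of_ne_of_ne] <;>
      simp only [ne_eq, Fin.ext_iff] <;> omega

/-- A simple reflection that does not change the leading coordinate fixes the vector. -/
theorem s_apply_eq_self {n i : ℕ} (hn : 2 ≤ n) (h1 : 1 ≤ i) (h2 : i ≤ n) (x : V n)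
    (h : ∀ k : Fin n, (k : ℕ) + 1 = leadIndex n i → (s n i).1 x k = x k) : (s n i).1 x = x := by
  unfold leadIndex at h
  ext k
  split_ifs at h with hi
  · subst hi
    have h' := h ⟨i - 2, by omega⟩ (by dsimp only; omega)
    rw [s_last_apply hn] at h' ⊢
    simp only [if_true] at h'
    split_ifs with ha hb
    · rw [h']; exact congrArg x.ofLp (Fin.ext ha.symm)
    · rw [← h', neg_neg]; exact congrArg x.ofLp (Fin.ext hb.symm)
    · rfl
  · have h' := h ⟨i - 1, by omega⟩ (by dsimp only; omega)
    rw [s_apply_of_lt h1 (by omega)] at h' ⊢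
    rw [Equiv.swap_apply_left] at h'
    by_cases ha : k = ⟨i - 1, by omega⟩
    · rw [ha, Equiv.swap_apply_left, h']
    by_cases hb : k = ⟨i, by omega⟩
    · rw [hb, Equiv.swap_apply_right, h']
    · rw [Equiv.swap_apply_of_ne_of_ne ha hb]

/-- A vector fixed by a product of simple reflections with increasing leading indices is fixed by
each of the factors: the first factor has to leave the leading coordinate unchanged, because the
later ones do. -/
theorem s_apply_eq_self_of_wordProd {n : ℕ} (hn : 2 ≤ n) (l : List ℕ)
    (hl : ∀ i ∈ l, 1 ≤ i ∧ i ≤ n) (hinc : l.Pairwise fun i j => leadIndex n i < leadIndex n j)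
    (x : V n) (hx : (wordProd n l).1 x = x) : ∀ i ∈ l, (s n i).1 x = x := by
  have hfix : ∀ (l : List ℕ) (m : ℕ), (∀ i ∈ l, 1 ≤ i ∧ i ≤ n) → (∀ i ∈ l, m < leadIndex n i) →
      ∀ (x : V n) (k : Fin n), (k : ℕ) + 1 = m → (wordProd n l).1 x k = x k := by
    intro l m hl hm x k hk
    induction l with
    | nil => rfl
    | cons i l ih =>
      rw [List.forall_mem_cons] at hl hm
      rw [wordProd_cons, coe_mul_apply, s_apply_of_lt_leadIndex hn hl.1.1 hl.1.2 _ _ (by omega),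
        ih hl.2 hm.2]
  induction l with
  | nil => simp
  | cons i l ih =>
    rw [List.forall_mem_cons] at hl ⊢
    rw [List.pairwise_cons] at hinc
    rw [wordProd_cons, coe_mul_apply] at hx
    have h : (s n i).1 ((wordProd n l).1 x) = (wordProd n l).1 x :=
      s_apply_eq_self hn hl.1.1 hl.1.2 _ fun k hk => by
        rw [hx, hfix l _ hl.2 hinc.1 x k hk]
    have h' : (wordProd n l).1 x = x := h.symm.trans hx
    rw [h'] at h
    exact ⟨h, ih hl.2 hinc.2 h'⟩

/-! ### The elements `w_β` -/

theorem mem_betaWord {j : ℕ} {β : List ℕ} {i : ℕ} (hi : i ∈ betaWord j β) :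
    j + 1 ≤ i ∧ i < j + β.sum := by
  induction β generalizing j with
  | nil => simp [betaWord] at hi
  | cons b β ih =>
    rw [betaWord, List.mem_append, List.mem_range'_1] at hi
    rw [List.sum_cons]
    rcases hi with hi | hi
    · omega
    · have := ih hi; omega

theorem betaWord_pairwise (j : ℕ) (β : List ℕ) : (betaWord j β).Pairwise (· < ·) := by
  induction β generalizing j with
  | nil => simp [betaWord]
  | cons b β ih =>
    rw [betaWord, List.pairwise_append]
    refine ⟨List.pairwise_lt_range', ih _, fun x hx y hy => ?_⟩
    rw [List.mem_range'_1] at hx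
    have := mem_betaWord hy
    omega

theorem mem_betaWord_of_even {j : ℕ} {β : List ℕ} (hβ : ∀ b ∈ β, Even b) {k : ℕ}
    (hk : 2 * k + 1 < β.sum) : j + 2 * k + 1 ∈ betaWord j β := by
  induction β generalizing j k with
  | nil => simp at hk
  | cons b β ih =>
    rw [List.forall_mem_cons] at hβ
    obtain ⟨⟨c, rfl⟩, hβ⟩ := hβ
    rw [List.sum_cons] at hk
    rw [betaWord, List.mem_append, List.mem_range'_1]
    by_cases h : k < c
    · left; omega
    · right
      have := ih (j := j + (c + c)) hβ (k := k - c) (by omega)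
      convert this using 1
      omega

theorem even_sum_of_even {β : List ℕ} (hβ : ∀ b ∈ β, Even b) : Even β.sum := by
  induction β with
  | nil => simp
  | cons b β ih =>
    rw [List.forall_mem_cons] at hβ
    rw [List.sum_cons]
    exact hβ.1.add (ih hβ.2)

theorem even_sum_of_pairs {m : ℕ} (a : ℕ → ℤ) (h : ∀ k < m, Even (a (2 * k) + a (2 * k + 1))) :
    Even (∑ i ∈ Finset.range (2 * m), a i) := by
  induction m with
  | zero => simp
  | succ m ih =>
    rw [show 2 * (m + 1) = 2 * m + 1 + 1 by ring, Finset.sum_range_succ, Finset.sum_range_succ,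
      add_assoc]
    exact (ih fun k hk => h k (by omega)).add (h m (by omega))

/-- If all parts of `β` are even, then the word of `β` contains all odd indices below `n`, so the
reflections along it, even with `s_n` in place of `s_{n-1}`, relate the coordinates `1` and `2`,
`3` and `4`, and so on. -/
theorem even_sum_of_fixed {n : ℕ} (hn : 2 ≤ n) {β : List ℕ} (hβ : ∀ b ∈ β, Even b)
    (hsum : β.sum = n) (z : V n) (a : Fin n → ℤ) (hza : ∀ i, z i = a i)
    (hz : ∀ i ∈ betaWord 0 β, (s n i).1 z = z ∨ i = n - 1 ∧ (s n n).1 z = z) :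
    Even (∑ i, a i) := by
  obtain ⟨m, hm⟩ := even_sum_of_even hβ
  have hmn : n = 2 * m := by omega
  let A : ℕ → ℤ := fun k => if h : k < n then a ⟨k, h⟩ else 0
  have hA : ∑ i, a i = ∑ i ∈ Finset.range (2 * m), A i := by
    rw [← hmn, ← Fin.sum_univ_eq_sum_range]
    exact Finset.sum_congr rfl fun i _ => by simp [A]
  rw [hA]
  refine even_sum_of_pairs A fun k hk => ?_
  have h1 : 2 * k < n := by omega
  have h2 : 2 * k + 1 < n := by omega
  simp only [A, dif_pos h1, dif_pos h2]
  rcases hz _ (mem_betaWord_of_even (j := 0) hβ (k := k) (by omega)) with h | ⟨hk', h⟩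
  · have h := congrArg (fun x : V n => x ⟨2 * k, h1⟩) h
    simp only [zero_add] at h
    rw [s_apply_of_lt (by omega) h2] at h
    simp only [Nat.add_sub_cancel, Equiv.swap_apply_left, hza, Int.cast_inj] at h
    rw [h]; exact ⟨_, rfl⟩
  · have h := congrArg (fun x : V n => x ⟨2 * k, h1⟩) h
    dsimp only at h
    rw [s_last_apply hn, if_pos (by dsimp only; omega)] at h
    simp only [hza, show n - 1 = 2 * k + 1 by omega] at h
    have : - a ⟨2 * k + 1, h2⟩ = a ⟨2 * k, h1⟩ := by exact_mod_cast h
    rw [← this]; simp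

theorem not_fillsMoveSet_wBeta {n : ℕ} (hn : 2 ≤ n) {β : List ℕ} (hβ : ∀ b ∈ β, Even b)
    (hsum : β.sum = n) : ¬ FillsMoveSet (wBeta n β) := by
  rw [fillsMoveSet_iff hn]
  rintro ⟨-, z, a, hz, hza, hodd⟩
  refine Int.not_even_iff_odd.2 hodd (even_sum_of_fixed hn hβ hsum z a hza fun i hi => Or.inl ?_)
  have hmem : ∀ i ∈ betaWord 0 β, 1 ≤ i ∧ i < n := fun i hi => by
    have := mem_betaWord hi; omega
  refine s_apply_eq_self_of_wordProd hn _ (fun i hi => ⟨(hmem i hi).1, (hmem i hi).2.le⟩) ?_ z hz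
    i hi
  refine (betaWord_pairwise 0 β).imp_of_mem fun {i j} hi hj hij => ?_
  rwa [leadIndex, leadIndex, if_neg (hmem i hi).2.ne, if_neg (hmem j hj).2.ne]

theorem not_fillsMoveSet_wBetaMinus {n : ℕ} (hn : 2 ≤ n) {β : List ℕ} (hβ : ∀ b ∈ β, Even b)
    (hsum : β.sum = n) : ¬ FillsMoveSet (wBetaMinus n β) := by
  rw [fillsMoveSet_iff hn]
  rintro ⟨-, z, a, hz, hza, hodd⟩
  have hmem : ∀ i ∈ betaWord 0 β, 1 ≤ i ∧ i < n := fun i hi => by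
    have := mem_betaWord hi; omega
  have hlead : ∀ i ∈ betaWord 0 β, leadIndex n (if i = n - 1 then n else i) = i := fun i hi => by
    have := hmem i hi
    unfold leadIndex
    split_ifs <;> omega
  have key := s_apply_eq_self_of_wordProd hn _ (fun i hi => ?_) ?_ z hz
  · refine Int.not_even_iff_odd.2 hodd (even_sum_of_fixed hn hβ hsum z a hza fun i hi => ?_)
    have := key _ (List.mem_map_of_mem hi)
    split_ifs at this with h
    · exact Or.inr ⟨h, this⟩
    · exact Or.inl this
  · obtain ⟨k, hk, rfl⟩ := List.mem_map.1 hi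
    have := hmem k hk
    split_ifs <;> omega
  · rw [List.pairwise_map]
    refine (betaWord_pairwise 0 β).imp_of_mem fun {i j} hi hj hij => ?_
    rwa [hlead i hi, hlead j hj]

theorem wordProd_apply_eq_self {n : ℕ} {l : List ℕ} {x : V n} (h : ∀ i ∈ l, (s n i).1 x = x) :
    (wordProd n l).1 x = x := by
  induction l with
  | nil => rfl
  | cons i l ih =>
    rw [List.forall_mem_cons] at h
    rw [wordProd_cons, coe_mul_apply, ih h.2, h.1]

theorem fillsMoveSet_wBeta {n : ℕ} (hn : 2 ≤ n) {β : List ℕ} (hβ : ∃ b ∈ β, Odd b)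
    (hsum : β.sum = n) : FillsMoveSet (wBeta n β) := by
  have hmem : ∀ i ∈ betaWord 0 β, 1 ≤ i ∧ i < n := fun i hi => by
    have := mem_betaWord hi; omega
  rw [fillsMoveSet_iff hn]
  refine ⟨⟨WithLp.toLp 2 fun _ => 1, wordProd_apply_eq_self fun i hi => ?_, by simp⟩, ?_⟩
  · ext k
    rw [s_apply_of_lt (hmem i hi).1 (hmem i hi).2]
  -- The indicator of an odd block is fixed.
  obtain ⟨b, hb, hodd⟩ := hβ
  obtain ⟨β₁, β₂, rfl⟩ := List.append_of_mem hb
  rw [List.sum_append, List.sum_cons] at hsum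
  have hblock : ∀ i ∈ betaWord 0 (β₁ ++ b :: β₂), i ≠ β₁.sum ∧ i ≠ β₁.sum + b := by
    have : ∀ (l : List ℕ) (j i : ℕ), i ∈ betaWord j (l ++ b :: β₂) →
        i ≠ j + l.sum ∧ i ≠ j + l.sum + b := by
      intro l
      induction l with
      | nil =>
        intro j i hi
        rw [List.nil_append, betaWord, List.mem_append, List.mem_range'_1] at hi
        rw [List.sum_nil]
        rcases hi with hi | hi
        · omega
        · have := mem_betaWord hi; omega
      | cons c l ih =>
        intro j i hi
        rw [List.cons_append, betaWord, List.mem_append, List.mem_range'_1] at hi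
        rw [List.sum_cons]
        rcases hi with hi | hi
        · omega
        · have := ih _ _ hi; omega
    intro i hi
    simpa using this β₁ 0 i hi
  let c : Fin n → ℤ := fun k => if β₁.sum ≤ (k : ℕ) ∧ (k : ℕ) < β₁.sum + b then 1 else 0
  refine ⟨WithLp.toLp 2 fun k => (c k : ℝ), c, wordProd_apply_eq_self fun i hi => ?_,
    fun i => rfl, ?_⟩
  · ext k
    have h1 := hmem i hi
    have h2 := hblock i hi
    rw [s_apply_of_lt h1.1 h1.2]
    dsimp only
    rw [Equiv.swap_apply_def]
    congr 1
    split_ifs with ha hb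
    · subst ha; simp only [c]; split_ifs <;> first | rfl | omega
    · subst hb; simp only [c]; split_ifs <;> first | rfl | omega
    · rfl
  · have : ∑ i, c i = b := by
      have : ∑ i, c i = ∑ k ∈ Finset.range n,
          if β₁.sum ≤ k ∧ k < β₁.sum + b then (1 : ℤ) else 0 := by
        rw [← Fin.sum_univ_eq_sum_range fun k =>
          if β₁.sum ≤ k ∧ k < β₁.sum + b then (1 : ℤ) else 0]
      rw [this, Finset.sum_boole]
      have : (Finset.range n).filter (fun k => β₁.sum ≤ k ∧ k < β₁.sum + b) =
          Finset.Ico β₁.sum (β₁.sum + b) := by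
        ext k; simp only [Finset.mem_filter, Finset.mem_range, Finset.mem_Ico]; omega
      rw [this]; simp
    rw [this]; exact_mod_cast hodd

/-! ### Nonempty `δ` -/

theorem u_apply {n j : ℕ} (h1 : 1 ≤ j) (h2 : j < n) (x : V n) (k : Fin n) :
    (u n j).1 x k = if (k : ℕ) = n - 1 - j ∨ (k : ℕ) = n - 1 then - x k else x k := by
  induction j, h1 using Nat.le_induction generalizing x k with
  | base =>
    rw [u, coe_mul_apply, s_last_apply (by omega)]
    simp only [s_apply_of_lt (show 1 ≤ n - 1 by omega) (show n - 1 < n by omega),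
      Equiv.swap_apply_def, Fin.ext_iff]
    split_ifs <;> first | omega | rfl | (refine congrArg (fun i => -x i) (Fin.ext ?_); dsimp only; omega)
  | succ j hj ih =>
    obtain ⟨i, rfl⟩ : ∃ i, j = i + 1 := ⟨j - 1, by omega⟩
    rw [u, coe_mul_apply, coe_mul_apply, s_apply_of_lt (by omega) (by omega), ih (by omega),
      s_apply_of_lt (by omega) (by omega), Equiv.swap_apply_self]
    simp only [Equiv.swap_apply_def, Fin.ext_iff]
    split_ifs <;> first | rfl | (simp only at *; omega)

/-- The sum of the first `m` coordinates. -/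
def headSum {n : ℕ} (m : ℕ) (x : V n) : ℝ := ∑ k : Fin n, if (k : ℕ) < m then x k else 0

/-- The Weyl group elements that preserve the sum of the first `m` coordinates. -/
def headStabilizer (n m : ℕ) : Submonoid (weylGroup n) where
  carrier := {g | ∀ x, headSum m (g.1 x) = headSum m x}
  one_mem' := fun _ => rfl
  mul_mem' := fun {g h} hg hh x => by rw [coe_mul_apply, hg, hh]

theorem mem_headStabilizer {n m : ℕ} {g : weylGroup n} :
    g ∈ headStabilizer n m ↔ ∀ x, headSum m (g.1 x) = headSum m x := Iff.rfl

theorem mem_headStabilizer_of_apply {n m : ℕ} {g : weylGroup n}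
    (h : ∀ x, ∀ k : Fin n, (k : ℕ) < m → g.1 x k = x k) : g ∈ headStabilizer n m := by
  intro x
  refine Finset.sum_congr rfl fun k _ => ?_
  split_ifs with hk
  · exact h x k hk
  · rfl

theorem s_mem_headStabilizer {n m i : ℕ} (h1 : 1 ≤ i) (h2 : i < n) (h : i ≠ m) :
    s n i ∈ headStabilizer n m := by
  intro x
  unfold headSum
  rw [← Equiv.sum_comp (Equiv.swap ⟨i - 1, by omega⟩ ⟨i, h2⟩) fun k : Fin n =>
    if (k : ℕ) < m then x k else 0]
  refine Finset.sum_congr rfl fun k _ => ?_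
  rw [s_apply_of_lt h1 h2]
  have : ((Equiv.swap (⟨i - 1, by omega⟩ : Fin n) ⟨i, h2⟩ k : ℕ) < m) ↔ (k : ℕ) < m := by
    simp only [Equiv.swap_apply_def, Fin.ext_iff]
    split_ifs <;> simp only <;> omega
  simp only [this]

theorem s_last_mem_headStabilizer {n m : ℕ} (h : m + 2 ≤ n) : s n n ∈ headStabilizer n m :=
  mem_headStabilizer_of_apply fun x k hk => by
    rw [s_last_apply (by omega), if_neg (by omega), if_neg (by omega)]

theorem u_mem_headStabilizer {n m j : ℕ} (hj : 1 ≤ j) (h : m + j < n) :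
    u n j ∈ headStabilizer n m :=
  mem_headStabilizer_of_apply fun x k hk => by
    rw [u_apply hj (by omega), if_neg (by omega)]

theorem wordProd_mem_headStabilizer {n m : ℕ} {l : List ℕ}
    (h : ∀ i ∈ l, 1 ≤ i ∧ i < n ∧ i ≠ m) : wordProd n l ∈ headStabilizer n m := by
  refine Submonoid.list_prod_mem _ fun g hg => ?_
  obtain ⟨i, hi, rfl⟩ := List.mem_map.1 hg
  exact s_mem_headStabilizer (h i hi).1 (h i hi).2.1 (h i hi).2.2

theorem vProd_mem_headStabilizer {n m j : ℕ} {ds : List ℕ} (hj : 1 ≤ j) (hds : ∀ d ∈ ds, 0 < d)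
    (h : m + (j + ds.sum) ≤ n) (hm : 1 ≤ m) : vProd n j ds ∈ headStabilizer n m := by
  induction ds generalizing j with
  | nil => exact one_mem _
  | cons d ds ih =>
    rw [List.forall_mem_cons] at hds
    rw [List.sum_cons] at h
    refine mul_mem (mul_mem (u_mem_headStabilizer hj (by omega))
      (wordProd_mem_headStabilizer fun i hi => ?_)) (ih (by omega) hds.2 (by omega))
    obtain ⟨k, hk, rfl⟩ := List.mem_map.1 hi
    rw [List.mem_range'_1] at hk
    omega

theorem headSum_u {n j : ℕ} (hj : 1 ≤ j) (hjn : j < n) (x : V n) :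
    headSum (n - j) ((u n j).1 x) = headSum (n - j) x - 2 * x ⟨n - 1 - j, by omega⟩ := by
  have : 2 * x ⟨n - 1 - j, by omega⟩ = ∑ k : Fin n, if k = ⟨n - 1 - j, by omega⟩ then
      2 * x k else 0 := by simp
  rw [headSum, headSum, this, ← Finset.sum_sub_distrib]
  refine Finset.sum_congr rfl fun k _ => ?_
  rw [u_apply hj hjn]
  simp only [Fin.ext_iff]
  split_ifs <;> first | omega | ring

theorem wordProd_apply_ne_zero {n : ℕ} {l : List ℕ} (hl : ∀ i ∈ l, 1 ≤ i ∧ i < n) {x : V n}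
    (hx : ∀ k, x k ≠ 0) (k : Fin n) : (wordProd n l).1 x k ≠ 0 := by
  induction l generalizing k with
  | nil => exact hx k
  | cons i l ih =>
    rw [List.forall_mem_cons] at hl
    rw [wordProd_cons, coe_mul_apply, s_apply_of_lt hl.1.1 hl.1.2]
    exact ih hl.2 _

/-- If `δ` is not empty, then every vector fixed by `w_β w_δ` has a zero coordinate. With `j` the
start of the last part of `δ`, the factor `u_j` of `w_δ` is the only one to change the sum of the
first `n - j` coordinates, and changes it by a multiple of a coordinate. -/
theorem not_fillsMoveSet_of_delta {n : ℕ} (hn : 2 ≤ n) {β δ : List ℕ} (h : IsIndexPair n β δ)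
    (hδ : δ.sum ≠ 0) : ¬ FillsMoveSet (wBeta n β * wDelta n δ) := by
  rw [fillsMoveSet_iff hn]
  rintro ⟨⟨x, hwx, hx⟩, -⟩
  obtain ⟨-, -, hpos, -, heven, hsum⟩ := h
  obtain - | ⟨d₀, ds⟩ := δ
  · simp at hδ
  rcases List.eq_nil_or_concat ds with rfl | ⟨ds, d, rfl⟩
  · simp at heven
  rw [List.concat_eq_append] at *
  rw [List.forall_mem_cons] at hpos
  have hds : ∀ d ∈ ds, 0 < d := fun a ha => hpos.2 a (by simp [ha])
  have hd : 0 < d := hpos.2 d (by simp)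
  have hd₀ := hpos.1
  simp only [List.sum_cons, List.sum_append, List.sum_nil, add_zero] at hsum
  set j := d₀ + ds.sum with hj
  have hfirst : (if 2 ≤ d₀ then u n 0 * wordProd n ((List.range' 2 (d₀ - 2)).map fun i => n - i)
      else 1) ∈ headStabilizer n (n - j) := by
    split_ifs with h2
    · refine mul_mem (s_last_mem_headStabilizer (by omega))
        (wordProd_mem_headStabilizer fun i hi => ?_)
      obtain ⟨k, hk, rfl⟩ := List.mem_map.1 hi
      rw [List.mem_range'_1] at hk
      omega
    · exact one_mem _
  have hA := mul_mem (mul_mem (wordProd_mem_headStabilizer (n := n) (m := n - j)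
    (l := betaWord 0 β) fun i hi => by have := mem_betaWord hi; omega) hfirst)
    (vProd_mem_headStabilizer (ds := ds) (j := d₀) hd₀ hds (m := n - j) (n := n)
      (by omega) (by omega))
  rw [wDelta, vProd_append, v, wBeta, ← mul_assoc, ← mul_assoc, ← mul_assoc, coe_mul_apply,
    ← hj] at hwx
  have hl : ∀ i ∈ (List.range' (j + 1) (d - 1)).map (fun i => n - i), 1 ≤ i ∧ i < n ∧ i < n - j :=
    fun i hi => by
      obtain ⟨k, hk, rfl⟩ := List.mem_map.1 hi
      rw [List.mem_range'_1] at hk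
      omega
  have h0 := congrArg (headSum (n - j)) hwx
  rw [coe_mul_apply, mem_headStabilizer.1 hA, headSum_u (by omega) (by omega),
    mem_headStabilizer.1 (wordProd_mem_headStabilizer fun i hi =>
      ⟨(hl i hi).1, (hl i hi).2.1, (hl i hi).2.2.ne⟩)] at h0
  exact wordProd_apply_ne_zero (fun i hi => ⟨(hl i hi).1, (hl i hi).2.1⟩) hx
    ⟨n - 1 - j, by omega⟩ (by linarith)

/-! ### Conjugacy -/

theorem FillsMoveSet.of_isConj {n : ℕ} (hn : 2 ≤ n) {w w' : weylGroup n} (h : IsConj w w')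
    (hw : FillsMoveSet w) : FillsMoveSet w' := by
  obtain ⟨g, rfl⟩ := isConj_iff.1 h
  rw [fillsMoveSet_iff hn] at hw ⊢
  obtain ⟨σ, ε, hg, hε⟩ := exists_isSignedPerm hn g
  have hconj : ∀ x, w.1 x = x → (g * w * g⁻¹).1 (g.1 x) = g.1 x := fun x hx => by
    rw [← coe_mul_apply, inv_mul_cancel_right, coe_mul_apply, hx]
  have hne : ∀ i, ((ε i : ℤ) : ℝ) ≠ 0 := fun i => by
    rcases Int.units_eq_one_or (ε i) with h | h <;> simp [h]
  obtain ⟨⟨x, hx, hx0⟩, z, a, hz, hza, hodd⟩ := hw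
  refine ⟨⟨g.1 x, hconj x hx, fun k => ?_⟩, g.1 z, fun k => ε (σ.symm k) * a (σ.symm k),
    hconj z hz, fun k => ?_, ?_⟩
  · obtain ⟨i, rfl⟩ := σ.surjective k
    rw [hg]
    exact mul_ne_zero (hne i) (hx0 i)
  · obtain ⟨i, rfl⟩ := σ.surjective k
    rw [hg, hza]
    simp only [Equiv.symm_apply_apply]
    push_cast; rfl
  · rw [Equiv.sum_comp σ.symm fun i => (ε i : ℤ) * a i]
    simpa using (even_sum_units_mul_sub_sum ε a).add_odd hodd

theorem fillsMoveSet_iff_of_classIndexedBy {n : ℕ} (hn : 2 ≤ n) {w : weylGroup n} {β δ : List ℕ}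
    (h : ClassIndexedBy w β δ) : FillsMoveSet w ↔ (∃ b ∈ β, Odd b) ∧ δ.sum = 0 := by
  obtain ⟨hp, hc⟩ := h
  have hconj : ∀ w', IsConj w w' → (FillsMoveSet w ↔ FillsMoveSet w') := fun w' h =>
    ⟨.of_isConj hn h, .of_isConj hn h.symm⟩
  rcases hc with hc | ⟨⟨h0, heven⟩, hc⟩
  · rw [hconj _ hc]
    by_cases hδ : δ.sum = 0
    · have hnil : δ = [] := by
        obtain - | ⟨d, ds⟩ := δ
        · rfl
        · have := hp.delta_pos d (by simp)
          rw [List.sum_cons] at hδ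
          omega
      subst hnil
      have hsum : β.sum = n := by simpa using hp.sum_eq
      rw [wDelta, mul_one]
      simp only [List.sum_nil, and_true]
      refine ⟨fun hf => ?_, fun hβ => fillsMoveSet_wBeta hn hβ hsum⟩
      by_contra! hβ
      exact not_fillsMoveSet_wBeta hn (fun b hb => Nat.not_odd_iff_even.1 (hβ b hb)) hsum hf
    · exact iff_of_false (not_fillsMoveSet_of_delta hn hp hδ) fun h => hδ h.2
  · rw [hconj _ hc]
    have hsum : β.sum = n := by have := hp.sum_eq; omega
    refine iff_of_false (not_fillsMoveSet_wBetaMinus hn heven hsum) ?_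
    rintro ⟨⟨b, hb, hodd⟩, -⟩
    exact Nat.not_even_iff_odd.2 hodd (heven b hb)

/-! ### Conjugation to a permutation matrix -/

theorem IsSignedPerm.ext {n : ℕ} {g h : weylGroup n} {σ : Equiv.Perm (Fin n)} {ε : Fin n → ℤˣ}
    (hg : IsSignedPerm g.1 σ ε) (hh : IsSignedPerm h.1 σ ε) : g = h := by
  refine Subtype.ext (LinearIsometryEquiv.ext fun x => ?_)
  ext k
  obtain ⟨i, rfl⟩ := σ.surjective k
  rw [hg, hh]

theorem IsSignedPerm.mul_of_one {n : ℕ} {g h : V n ≃ₗᵢ[ℝ] V n} {σ τ : Equiv.Perm (Fin n)}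
    (hg : IsSignedPerm g σ 1) (hh : IsSignedPerm h τ 1) : IsSignedPerm (g * h) (σ * τ) 1 :=
  fun x i => (hg.mul hh x i).trans (by simp)

/-- All permutation matrices lie in the Weyl group. -/
theorem exists_isSignedPerm_perm {n : ℕ} (hn : 1 ≤ n) (σ : Equiv.Perm (Fin n)) :
    ∃ g : weylGroup n, IsSignedPerm g.1 σ 1 := by
  obtain ⟨m, rfl⟩ : ∃ m, n = m + 1 := ⟨n - 1, by omega⟩
  have hσ : σ ∈ Submonoid.closure (Set.range fun i : Fin m => Equiv.swap i.castSucc i.succ) := by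
    rw [Equiv.Perm.mclosure_swap_castSucc_succ]; trivial
  induction hσ using Submonoid.closure_induction with
  | mem τ hτ =>
    obtain ⟨i, rfl⟩ := hτ
    exact ⟨s (m + 1) (i + 1), isSignedPerm_s_of_lt (by omega) (by omega)⟩
  | one => exact ⟨1, fun x i => by simp⟩
  | mul σ τ _ _ hσ hτ =>
    obtain ⟨g, hg⟩ := hσ
    obtain ⟨h, hh⟩ := hτ
    exact ⟨g * h, hg.mul_of_one hh⟩

/-- All diagonal matrices with an even number of entries `-1` and the other entries `1` lie in the
Weyl group. -/
theorem exists_isSignedPerm_diag {n : ℕ} (hn : 2 ≤ n) (t : Fin n → ℤˣ) (ht : ∏ i, t i = 1) :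
    ∃ g : weylGroup n, IsSignedPerm g.1 1 t := by
  let l : Fin n := ⟨n - 1, by omega⟩
  -- Outside of the last coordinate, any signs can be prescribed by means of the elements `u_j`.
  have key : ∀ T : Finset (Fin n), l ∉ T → ∃ (g : weylGroup n) (r : Fin n → ℤˣ),
      IsSignedPerm g.1 1 r ∧ ∏ i, r i = 1 ∧ ∀ k ≠ l, r k = if k ∈ T then -1 else 1 := by
    intro T
    induction T using Finset.induction_on with
    | empty => exact fun _ => ⟨1, 1, fun x i => by simp, by simp, by simp⟩
    | insert a T ha ih =>
      intro hl
      rw [Finset.mem_insert, not_or] at hl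
      obtain ⟨g, r, hg, hr, hrk⟩ := ih hl.2
      have hal : (a : ℕ) < n - 1 := by
        have : (a : ℕ) ≠ n - 1 := fun h => hl.1 (Fin.ext h.symm)
        omega
      have hu : IsSignedPerm (u n (n - 1 - a)).1 1
          fun k => (if k = a then -1 else 1) * (if k = l then -1 else 1) := by
        intro x k
        rw [Equiv.Perm.one_apply, u_apply (by omega) (by omega)]
        by_cases h1 : k = a
        · subst h1
          rw [if_pos (Or.inl (by omega))]
          simp [Ne.symm hl.1]
        by_cases h2 : k = l
        · subst h2
          rw [if_pos (Or.inr rfl)]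
          simp [hl.1]
        · rw [if_neg]
          · simp [h1, h2]
          · rintro (h | h)
            · exact h1 (Fin.ext (by omega))
            · exact h2 (Fin.ext h)
      refine ⟨g * u n (n - 1 - a), _, hg.mul hu, ?_, fun k hk => ?_⟩
      · simp only [Equiv.Perm.one_apply]
        rw [Finset.prod_mul_distrib, hr, Finset.prod_mul_distrib, Finset.prod_ite_eq',
          Finset.prod_ite_eq']
        simp
      · rw [Equiv.Perm.one_apply, hrk k hk, if_neg hk]
        by_cases h : k = a
        · subst h; simp [ha]
        · simp [h]
  obtain ⟨g, r, hg, hr, hrk⟩ := key (Finset.univ.filter fun k => k ≠ l ∧ t k = -1) (by simp)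
  have hrt : ∀ k ≠ l, r k = t k := fun k hk => by
    rw [hrk k hk]
    rcases Int.units_eq_one_or (t k) with h | h <;> simp [h, hk]
  have hrl : r l = t l := by
    have h := Fintype.prod_eq_single (f := fun k => r k * t k) l fun k hk => by
      rw [hrt k hk, Int.units_mul_self]
    rw [Finset.prod_mul_distrib, hr, ht, one_mul] at h
    rw [← mul_one (r l), ← Int.units_mul_self (t l), ← mul_assoc, ← h, one_mul]
  refine ⟨g, ?_⟩
  convert hg using 1
  ext k
  by_cases hk : k = l
  · rw [hk, hrl]
  · rw [hrt k hk]

/-- A block of `w_β` is the permutation matrix of a cycle on consecutive indices. -/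
theorem isSignedPerm_wordProd_range' {n : ℕ} (b : ℕ) : ∀ j, j + (b + 1) ≤ n →
    ∃ L : List (Fin n), L.map Fin.val = List.range' j (b + 1) ∧
      IsSignedPerm (wordProd n (List.range' (j + 1) b)).1 L.formPerm 1 := by
  induction b with
  | zero =>
    intro j hj
    exact ⟨[⟨j, by omega⟩], rfl, fun x i => by simp [wordProd]⟩
  | succ b ih =>
    intro j hj
    obtain ⟨L, hL, hw⟩ := ih (j + 1) (by omega)
    obtain - | ⟨y, L⟩ := L
    · simp [List.range'_succ] at hL
    have hy : y = ⟨j + 1, by omega⟩ := by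
      rw [List.range'_succ, List.map_cons, List.cons.injEq] at hL
      exact Fin.ext hL.1
    refine ⟨⟨j, by omega⟩ :: y :: L, by rw [List.map_cons, hL, ← List.range'_succ], ?_⟩
    rw [List.range'_succ, wordProd_cons, List.formPerm_cons_cons]
    have h := (isSignedPerm_s_of_lt (n := n) (i := j + 1) (by omega) (by omega)).mul_of_one hw
    simpa [hy] using! h

/-- The element `w_β` is the permutation matrix of a permutation with cycle type `β`, up to
the parts `1`, which stand for fixed points. -/
theorem isSignedPerm_betaWord {n : ℕ} (β : List ℕ) (hβ : ∀ b ∈ β, 0 < b) :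
    ∀ j, j + β.sum ≤ n → ∃ σ : Equiv.Perm (Fin n),
      IsSignedPerm (wordProd n (betaWord j β)).1 σ 1 ∧
      σ.cycleType = (β : Multiset ℕ).filter (2 ≤ ·) ∧ ∀ k : Fin n, (k : ℕ) < j → σ k = k := by
  induction β with
  | nil => exact fun j _ => ⟨1, fun x i => by simp [betaWord, wordProd], by simp, by simp⟩
  | cons b β ih =>
    intro j hj
    rw [List.forall_mem_cons] at hβ
    rw [List.sum_cons] at hj
    obtain ⟨c, rfl⟩ : ∃ c, b = c + 1 := ⟨b - 1, by omega⟩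
    obtain ⟨τ, hτ, hτc, hτf⟩ := ih hβ.2 (j + (c + 1)) (by omega)
    obtain ⟨L, hL, hw⟩ := isSignedPerm_wordProd_range' (n := n) c j (by omega)
    have hmem : ∀ k ∈ L, j ≤ (k : ℕ) ∧ (k : ℕ) < j + (c + 1) := fun k hk => by
      have : (k : ℕ) ∈ L.map Fin.val := List.mem_map_of_mem hk
      rwa [hL, List.mem_range'_1] at this
    have hnodup : L.Nodup := by
      refine List.Nodup.of_map Fin.val ?_
      rw [hL]; exact List.nodup_range'
    have hlen : L.length = c + 1 := by
      rw [← List.length_map (f := Fin.val), hL, List.length_range']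
    have hdisj : L.formPerm.Disjoint τ := fun k => by
      by_cases hk : k ∈ L
      · exact Or.inr (hτf k (hmem k hk).2)
      · exact Or.inl (List.formPerm_apply_of_notMem hk)
    refine ⟨L.formPerm * τ, ?_, ?_, fun k hk => ?_⟩
    · rw [betaWord, wordProd_append, Nat.add_sub_cancel]
      exact hw.mul_of_one hτ
    · rw [hdisj.cycleType_mul, hτc, ← Multiset.cons_coe, ← Multiset.singleton_add,
        Multiset.filter_add]
      congr 1
      rcases Nat.eq_zero_or_pos c with rfl | hc
      · obtain ⟨y, rfl⟩ := List.length_eq_one_iff.1 hlen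
        simp [Multiset.filter_singleton]
      · rw [(List.isCycle_formPerm hnodup (by omega)).cycleType, List.support_formPerm_of_nodup _
          hnodup, List.toFinset_card_of_nodup hnodup, hlen, Multiset.filter_singleton,
          if_pos (by omega)]
        rintro x rfl
        simp at hlen; omega
    · rw [Equiv.Perm.mul_apply, hτf k (by omega), List.formPerm_apply_of_notMem]
      exact fun h => by have := hmem k h; omega

/-- A permutation matrix is conjugate to `w_β`, with `β` the cycle type of the permutation. -/
theorem exists_isConj_wBeta_of_perm {n : ℕ} (hn : 1 ≤ n) {w : weylGroup n}
    {σ : Equiv.Perm (Fin n)} (hw : IsSignedPerm w.1 σ 1) :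
    ∃ β, IsDecreasingPartition β n ∧ IsConj w (wBeta n β) := by
  let β := σ.partition.parts.sort (· ≥ ·)
  have hβ : (β : Multiset ℕ) = σ.partition.parts := Multiset.sort_eq _ _
  have hpos : ∀ b ∈ β, 0 < b := fun b hb =>
    σ.partition.parts_pos ((Multiset.mem_sort _).1 hb)
  have hsum : β.sum = n := by
    rw [← Multiset.sum_coe, hβ, σ.partition.parts_sum, Fintype.card_fin]
  obtain ⟨τ, hτ, hτc, -⟩ := isSignedPerm_betaWord (n := n) β hpos 0 (by omega)
  refine ⟨β, ⟨hpos, Multiset.pairwise_sort _ _, hsum⟩, ?_⟩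
  have hc : IsConj σ τ := by
    rw [Equiv.Perm.isConj_iff_cycleType_eq, hτc, hβ]
    exact Equiv.Perm.filter_parts_partition_eq_cycleType.symm
  obtain ⟨ρ, rfl⟩ := isConj_iff.1 hc
  obtain ⟨g, hg⟩ := exists_isSignedPerm_perm hn ρ
  refine isConj_iff.2 ⟨g, IsSignedPerm.ext ?_ hτ⟩
  exact (hg.mul_of_one hw).mul_of_one hg.inv

theorem prod_negOnePow {ι : Type*} [Fintype ι] (a : ι → ℤ) :
    ∏ i, (a i).negOnePow = (∑ i, a i).negOnePow := by
  classical
  induction (Finset.univ : Finset ι) using Finset.induction_on with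
  | empty => simp
  | insert i t hi ih =>
    rw [Finset.prod_insert hi, Finset.sum_insert hi, ih, Int.negOnePow_add]

/-- An element that fills its move-set is conjugate to an element `w_β` of type `A_{n-1}`. -/
theorem exists_isConj_wBeta {n : ℕ} (hn : 2 ≤ n) {w : weylGroup n} (hf : FillsMoveSet w) :
    ∃ β, IsDecreasingPartition β n ∧ IsConj w (wBeta n β) := by
  obtain ⟨⟨x, hx, hx0⟩, z, a, hz, hza, hodd⟩ := (fillsMoveSet_iff hn w).1 hf
  obtain ⟨σ, ε, hw, -⟩ := exists_isSignedPerm hn w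
  -- It is enough to find a fixed sign vector with an even number of signs: conjugation by the
  -- corresponding diagonal matrix turns `w` into a permutation matrix.
  suffices h : ∃ t : Fin n → ℤˣ, ∏ i, t i = 1 ∧ ∀ i, t (σ i) = ε i * t i by
    obtain ⟨t, ht, htσ⟩ := h
    obtain ⟨g, hg⟩ := exists_isSignedPerm_diag hn t ht
    have hperm : IsSignedPerm (g⁻¹ * w * g⁻¹⁻¹).1 σ 1 := by
      rw [inv_inv]
      intro x i
      refine ((hg.inv.mul hw).mul hg x i).trans ?_
      have h : t (σ i) * ε i * t i = 1 := by
        rw [htσ, mul_assoc, Int.units_mul_self]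
      simp only [inv_one, Equiv.Perm.one_apply, Pi.one_apply, h]
    obtain ⟨β, hβ, hc⟩ := exists_isConj_wBeta_of_perm (by omega) hperm
    exact ⟨β, hβ, (isConj_iff.2 ⟨g⁻¹, rfl⟩ : IsConj w _).trans hc⟩
  let t : Fin n → ℤˣ := fun i => if 0 < x i then 1 else -1
  have ht : ∀ i, t (σ i) = ε i * t i := fun i => by
    have h1 := hw x i
    rw [hx] at h1
    have h2 := hx0 i
    simp only [t, h1]
    rcases Int.units_eq_one_or (ε i) with h | h
    · simp [h]
    · rcases h2.lt_or_gt with h2 | h2 <;> simp [h, h2, h2.not_gt]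
  rcases Int.units_eq_one_or (∏ i, t i) with h | h
  · exact ⟨t, h, ht⟩
  · -- Flip the signs where the fixed integral vector is odd: these are an odd number of places.
    refine ⟨fun i => t i * (a i).negOnePow, ?_, fun i => ?_⟩
    · rw [Finset.prod_mul_distrib, h, prod_negOnePow, Int.negOnePow_odd _ hodd]; rfl
    · have h1 := hw z i
      rw [hz, hza, hza] at h1
      have h2 : a (σ i) = (ε i : ℤ) * a i :=
        Int.cast_injective (α := ℝ) (by rw [h1]; push_cast; rfl)
      have h3 : (a (σ i)).negOnePow = (a i).negOnePow := by
        rw [h2]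
        rcases Int.units_eq_one_or (ε i) with h | h <;> simp [h]
      dsimp only
      rw [ht, h3, mul_assoc]

theorem wBeta_mem_typeASubgroup {n : ℕ} {β : List ℕ} (h : β.sum = n) :
    wBeta n β ∈ typeASubgroup n := by
  refine Subgroup.list_prod_mem _ fun g hg => ?_
  obtain ⟨i, hi, rfl⟩ := List.mem_map.1 hg
  have := mem_betaWord hi
  exact Subgroup.subset_closure ⟨i, by omega, by omega, rfl⟩

end TypeD

end

theorem corollary1p11 (n : ℕ) (hn : 4 ≤ n) :
    (∀ (w : TypeD.weylGroup n) (β δ : List ℕ), TypeD.ClassIndexedBy w β δ →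
      (TypeD.FillsMoveSet w ↔ (∃ b ∈ β, Odd b) ∧ δ.sum = 0)) ∧
    (∀ w : TypeD.weylGroup n,
      (¬ ∃ β : List ℕ, TypeD.IsDecreasingPartition β n ∧
        TypeD.wBeta n β ∈ TypeD.typeASubgroup n ∧ IsConj w (TypeD.wBeta n β)) →
      ¬ TypeD.FillsMoveSet w) := by
  refine ⟨fun w β δ h => TypeD.fillsMoveSet_iff_of_classIndexedBy (by omega) h,
    fun w hw hf => hw ?_⟩
  obtain ⟨β, hβ, hc⟩ := TypeD.exists_isConj_wBeta (by omega) hf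
  exact ⟨β, hβ, TypeD.wBeta_mem_typeASubgroup hβ.sum_eq, hc⟩
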